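/- Let $d\ge 3$ and fix $\alpha_0>0$. For $\alpha\ge\alpha_0$ and $x\in\mathbb{R}^d$ let $W^\alpha_x$ denote the Wiener measure on $C([0,\infty);\mathbb{R}^d)$ of Brownian motion with variance $\alpha$ started from $x$, i.e. the law of $x+\sqrt{\alpha}\,B_t$ for a standard $d$-dimensional Brownian motion $B$. For an open set $V\subset\mathbb{R}^d$ let $\tau_V=\inf\{t\ge 0 : X_t\notin V\}$ be the exit time of the canonical process $X$ from $V$. (i) For all $0<r_1<r_2<\infty$ there is $C=C(r_1,r_2)>0$, depending only on $d,\alpha_0,r_1,r_2$, such that for every $\alpha\ge\alpha_0$, with $A_{r_1,r_2}=B_{r_2}\setminus\overline{B}_{r_1}$, $$E^{W^\alpha_x}(\tau_{A_{r_1,r_2}})\le C\, d(x,\partial B_{r_1})\quad\text{for all } x\in\overline{A}_{r_1,r_2}.$$ (ii) Let $U\subset\mathbb{R}^d$ be open and bounded and satisfy an exterior ball condition of radius $r_0>0$: for each $x\in\partial U$ there is $x^*\in\mathbb{R}^d$ with $\overline{B}_{r_0}(x^*)\cap\overline{U}=\{x\}$. For $\delta>0$ put $U_\delta=\{x\in\mathbb{R}^d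 : d(x,U)<\delta\}$. Then there is $C>0$, depending only on $d$, $\alpha_0$, $U$ and $r_0$, such that for every $\alpha\ge\alpha_0$ and every $0<\delta<r_0/2$, $$\sup_{d(x,\partial U)\le\delta}E^{W^\alpha_x}(\tau_U)\le C\delta\qquad\text{and}\qquad \sup_{d(x,\partial U_\delta)\le 2\delta}E^{W^\alpha_x}(\tau_{U_\delta})<C\delta .$$ -/

import Mathlib

open MeasureTheory ProbabilityTheory
open scoped NNReal ENNReal

noncomputable section

/-- The path space `C([0,∞); ℝ^d)`. -/
abbrev PathSpace (d : ℕ) : Type := C(ℝ≥0, EuclideanSpace ℝ (Fin d))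

/-- The canonical sigma algebra on path space, generated by the coordinate maps `w ↦ w t`. -/
instance instMeasurableSpacePathSpace (d : ℕ) : MeasurableSpace (PathSpace d) :=
  MeasurableSpace.comap (fun (w : PathSpace d) (t : ℝ≥0) => w t) MeasurableSpace.pi

/-- A standard `d`-dimensional Brownian motion (started from the origin): the coordinates are
independent standard real Brownian motions. -/
structure IsStdBrownianMotion {Ω : Type*} {mΩ : MeasurableSpace Ω} {d : ℕ}
    (B : ℝ≥0 → Ω → EuclideanSpace ℝ (Fin d)) (P : Measure Ω) : Prop where
  isBrownianReal : ∀ i : Fin d, IsBrownianReal (fun t ω => B t ω i) P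
  indep : iIndepFun (fun (i : Fin d) (ω : Ω) (t : ℝ≥0) => B t ω i) P

/-- `W` is the Wiener measure on path space of Brownian motion with variance `α > 0` started from
`x`: under `W`, the coordinate process is `X t = x + √α B t` for a standard Brownian motion `B`. -/
def IsWienerMeasure {d : ℕ} (α : ℝ) (x : EuclideanSpace ℝ (Fin d))
    (W : Measure (PathSpace d)) : Prop :=
  IsStdBrownianMotion (fun (t : ℝ≥0) (w : PathSpace d) => (√α)⁻¹ • (w t - x)) W

/-- The exit time `inf {t ≥ 0 | X t ∉ V}`, with value `∞` on paths that never leave `V`. -/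
def exitTime {d : ℕ} (V : Set (EuclideanSpace ℝ (Fin d))) (w : PathSpace d) : ℝ≥0∞ :=
  ⨅ (t : ℝ≥0) (_ : w t ∉ V), (t : ℝ≥0∞)

/-- The open annulus `B_{r₂} \ closure B_{r₁}` about the origin. -/
def annulus (d : ℕ) (r₁ r₂ : ℝ) : Set (EuclideanSpace ℝ (Fin d)) :=
  Metric.ball 0 r₂ \ Metric.closedBall 0 r₁

/-- The exterior ball condition with radius `r₀`: every boundary point `x` of `U` is touched by a
closed ball of radius `r₀` that meets the closure of `U` only at `x`. -/
def ExteriorBallCondition {d : ℕ} (U : Set (EuclideanSpace ℝ (Fin d))) (r₀ : ℝ) : Prop :=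
  ∀ x ∈ frontier U, ∃ y : EuclideanSpace ℝ (Fin d), Metric.closedBall y r₀ ∩ closure U = {x}

end

/-! Both parts reduce to a set `V` lying between radii `r₁` and `R` about a centre `y`. Far enough
from `y`, `exp (-c‖z - y‖²)` is strictly subharmonic, so a multiple of its negative drops at least
at unit rate along the motion for every `α ≥ α₀`. A function with such a drop bounds the mean exit
time, and this one grows linearly with the distance from the inner ball.

The argument runs in discrete time, with neither stochastic integrals nor stopping times: the exit
time is at most the first exit time along a grid of mesh `h`, and `lintegral_exitTime_le` needs only
the Markov property at grid times and a nonnegative `u` whose one-step Gaussian average is at most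
`u - h` on the annulus. A grid step may land deep in the inner ball, where the subharmonic term
alone would be negative; `barrier` adds a peak there, whose average seen from outside is
exponentially small in `1/h` (`integral_barrier_add_le`, `barrier_le`). The mesh may depend on
everything, since only `h ≤ δ` enters the final bound.

For a domain, `y` is the centre of an exterior ball at a boundary point near `x`. -/

/-- If the pairs `(X i, Y i)` are independent and each `X i` is independent of `Y i`, then the
family `X` is independent of the family `Y`. -/
theorem ProbabilityTheory.iIndepFun.indepFun_pi_of_prodMk {ι Ω 𝓧 𝓨 : Type*} [Fintype ι]
    {mΩ : MeasurableSpace Ω} {m𝓧 : MeasurableSpace 𝓧} {m𝓨 : MeasurableSpace 𝓨}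
    {P : Measure Ω} [IsProbabilityMeasure P] {X : ι → Ω → 𝓧} {Y : ι → Ω → 𝓨}
    (hX : ∀ i, Measurable (X i)) (hY : ∀ i, Measurable (Y i))
    (h : iIndepFun (fun i ω => (X i ω, Y i ω)) P) (hXY : ∀ i, IndepFun (X i) (Y i) P) :
    IndepFun (fun ω i => X i ω) (fun ω i => Y i ω) P := by
  have hX' : iIndepFun X P := h.comp (fun _ => Prod.fst) fun _ => measurable_fst
  have hY' : iIndepFun Y P := h.comp (fun _ => Prod.snd) fun _ => measurable_snd
  rw [indepFun_iff_map_prod_eq_prod_map_map (measurable_pi_lambda _ hX).aemeasurable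
    (measurable_pi_lambda _ hY).aemeasurable,
    (iIndepFun_iff_map_fun_eq_pi_map fun i => (hX i).aemeasurable).1 hX',
    (iIndepFun_iff_map_fun_eq_pi_map fun i => (hY i).aemeasurable).1 hY']
  have : ∀ i, IsProbabilityMeasure (P.map (X i)) :=
    fun i => Measure.isProbabilityMeasure_map (hX i).aemeasurable
  have : ∀ i, IsProbabilityMeasure (P.map (Y i)) :=
    fun i => Measure.isProbabilityMeasure_map (hY i).aemeasurable
  rw [← (measurePreserving_arrowProdEquivProdArrow 𝓧 𝓨 ι (fun i => P.map (X i))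
    fun i => P.map (Y i)).map_eq]
  have hpair : (fun i => (P.map (X i)).prod (P.map (Y i)))
      = fun i => P.map fun ω => (X i ω, Y i ω) := funext fun i =>
    ((indepFun_iff_map_prod_eq_prod_map_map (hX i).aemeasurable (hY i).aemeasurable).1
      (hXY i)).symm
  rw [hpair, ← (iIndepFun_iff_map_fun_eq_pi_map
    fun i => ((hX i).prodMk (hY i)).aemeasurable).1 h,
    Measure.map_map (MeasurableEquiv.measurable _)
      (measurable_pi_lambda _ fun i => (hX i).prodMk (hY i))]
  rfl

/-! ### Gaussian convolution estimates -/

/-- The Gaussian convolution of a Gaussian function, in dimension one. -/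
theorem integral_exp_neg_mul_add_sq_gaussianReal {c : ℝ} (hc : 0 < c) (v : ℝ≥0) (hv : v ≠ 0)
    (a : ℝ) :
    ∫ z, Real.exp (-c * (a + z) ^ 2) ∂gaussianReal 0 v
      = (√(1 + 2 * c * v))⁻¹ * Real.exp (-c * a ^ 2 / (1 + 2 * c * v)) := by
  have hv' : (0 : ℝ) < v := by exact_mod_cast pos_iff_ne_zero.2 hv
  have hq : 0 < 1 + 2 * c * v := by positivity
  rw [integral_gaussianReal_eq_integral_smul hv]
  simp only [gaussianPDFReal, smul_eq_mul, sub_zero]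
  have key : ∀ z : ℝ, (√(2 * Real.pi * v))⁻¹ * Real.exp (-z ^ 2 / (2 * v))
        * Real.exp (-c * (a + z) ^ 2)
      = ((√(2 * Real.pi * v))⁻¹ * Real.exp (-c * a ^ 2 / (1 + 2 * c * v)))
        * Real.exp (-((1 + 2 * c * v) / (2 * v)) * (z + 2 * v * c * a / (1 + 2 * c * v)) ^ 2) := by
    intro z
    generalize (√(2 * Real.pi * v))⁻¹ = s
    rw [mul_assoc, mul_assoc, ← Real.exp_add, ← Real.exp_add]
    congr 2
    field_simp
    ring
  simp_rw [key]
  rw [integral_const_mul, integral_add_right_eq_self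
    (fun z : ℝ => Real.exp (-((1 + 2 * c * v) / (2 * v)) * z ^ 2)), integral_gaussian]
  have : Real.pi / ((1 + 2 * c * v) / (2 * v)) = (2 * Real.pi * v) / (1 + 2 * c * v) := by
    field_simp
  rw [this, Real.sqrt_div (by positivity)]
  have : √(2 * Real.pi * v) ≠ 0 := by positivity
  field_simp

/-- The centred Gaussian measure on `ℝ^d` with covariance `v • 1`, in coordinates. -/
noncomputable abbrev isoGaussian (d : ℕ) (v : ℝ≥0) : Measure (Fin d → ℝ) :=
  Measure.pi fun _ => gaussianReal 0 v

theorem exp_neg_mul_norm_add_sq {d : ℕ} (c : ℝ) (a : EuclideanSpace ℝ (Fin d)) (z : Fin d → ℝ) :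
    Real.exp (-c * ‖a + WithLp.toLp 2 z‖ ^ 2) = ∏ i, Real.exp (-c * (a i + z i) ^ 2) := by
  rw [EuclideanSpace.real_norm_sq_eq, Finset.mul_sum, Real.exp_sum]
  rfl

theorem integrable_exp_neg_mul_norm_add_sq {d : ℕ} {c : ℝ} (hc : 0 < c) (v : ℝ≥0)
    (a : EuclideanSpace ℝ (Fin d)) :
    Integrable (fun z => Real.exp (-c * ‖a + WithLp.toLp 2 z‖ ^ 2)) (isoGaussian d v) := by
  refine Integrable.of_bound (C := 1) (by fun_prop) (.of_forall fun z => ?_)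
  rw [Real.norm_eq_abs, Real.abs_exp, Real.exp_le_one_iff]
  nlinarith [sq_nonneg ‖a + WithLp.toLp 2 z‖]

/-- The Gaussian convolution of a Gaussian function on `ℝ^d`. -/
theorem integral_exp_neg_mul_norm_add_sq {d : ℕ} {c : ℝ} (hc : 0 < c) (v : ℝ≥0) (hv : v ≠ 0)
    (a : EuclideanSpace ℝ (Fin d)) :
    ∫ z, Real.exp (-c * ‖a + WithLp.toLp 2 z‖ ^ 2) ∂isoGaussian d v
      = (√(1 + 2 * c * v))⁻¹ ^ d * Real.exp (-c * ‖a‖ ^ 2 / (1 + 2 * c * v)) := by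
  simp_rw [exp_neg_mul_norm_add_sq]
  rw [integral_fintype_prod_eq_prod (fun i z => Real.exp (-c * (a i + z) ^ 2))]
  simp_rw [integral_exp_neg_mul_add_sq_gaussianReal hc v hv]
  rw [Finset.prod_mul_distrib, ← Real.exp_sum, ← Finset.sum_div, ← Finset.mul_sum,
    EuclideanSpace.real_norm_sq_eq]
  simp

/-- Away from the origin a narrow Gaussian function is strictly subharmonic: its Gaussian
convolution grows at least linearly in the variance. -/
theorem le_integral_exp_neg_mul_norm_add_sq {d : ℕ} {c : ℝ} (hc : 0 < c) (v : ℝ≥0) (hv : v ≠ 0)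
    (hcv : 6 * c * v ≤ 1) (a : EuclideanSpace ℝ (Fin d)) (ha : d ≤ c * ‖a‖ ^ 2) :
    Real.exp (-c * ‖a‖ ^ 2) * (1 + d * c * v / 2)
      ≤ ∫ z, Real.exp (-c * ‖a + WithLp.toLp 2 z‖ ^ 2) ∂isoGaussian d v := by
  have hv' : (0 : ℝ) < v := by exact_mod_cast pos_iff_ne_zero.2 hv
  rw [integral_exp_neg_mul_norm_add_sq hc v hv]
  -- Here `t ≤ 1/3`. The prefactor costs at most `dt/2` in the exponent and the wider Gaussian gains
  -- at least `3dt/4`, a net gain of `dt/4 = dcv/2`.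
  set t : ℝ := 2 * c * v with ht
  have ht0 : 0 < t := by positivity
  have h1 : Real.exp (-(t / 2)) ≤ (√(1 + t))⁻¹ := by
    rw [Real.exp_neg]
    refine inv_anti₀ (by positivity) (Real.sqrt_le_iff.2 ⟨by positivity, ?_⟩)
    rw [← Real.exp_nat_mul]
    have := Real.add_one_le_exp (((2 : ℕ) : ℝ) * (t / 2))
    push_cast at this ⊢
    linarith
  have h2 : Real.exp (-(t / 2) * d) ≤ (√(1 + t))⁻¹ ^ d := by
    rw [mul_comm, Real.exp_nat_mul]
    gcongr
  calc _ ≤ Real.exp (-c * ‖a‖ ^ 2) * Real.exp (d * c * v / 2) := by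
        gcongr
        linarith [Real.add_one_le_exp (d * c * v / 2)]
    _ ≤ Real.exp (-(t / 2) * d) * Real.exp (-c * ‖a‖ ^ 2 / (1 + t)) := by
        rw [← Real.exp_add, ← Real.exp_add]
        refine Real.exp_le_exp.2 ?_
        have e : -c * ‖a‖ ^ 2 / (1 + t) = -c * ‖a‖ ^ 2 + c * ‖a‖ ^ 2 * (t / (1 + t)) := by
          field_simp
          ring
        have h3 : 3 / 4 * t ≤ t / (1 + t) := by
          rw [le_div_iff₀ (by positivity)]
          nlinarith
        have h4 : d * (3 / 4 * t) ≤ c * ‖a‖ ^ 2 * (t / (1 + t)) := by gcongr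
        have h5 : d * c * v / 2 = d * t / 4 := by rw [ht]; ring
        rw [e, h5]
        linarith
    _ ≤ _ := by gcongr

/-- Quadratic decay in `v` suffices to beat the linear time step, and it gives an explicit
admissible mesh. -/
theorem exp_neg_div_le {κ v : ℝ} (hκ : 0 < κ) (hv : 0 < v) :
    Real.exp (-(κ / v)) ≤ 2 * v ^ 2 / κ ^ 2 := by
  have h := Real.quadratic_le_exp_of_nonneg (x := κ / v) (by positivity)
  rw [Real.exp_neg, inv_le_comm₀ (by positivity) (by positivity)]
  have : (2 * v ^ 2 / κ ^ 2)⁻¹ = (κ / v) ^ 2 / 2 := by field_simp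
  rw [this]
  have : 0 < κ / v := by positivity
  linarith

/-- The Gaussian convolution of a high Gaussian peak is tiny outside the peak. -/
theorem integral_exp_mul_sub_norm_add_sq_le {d : ℕ} {p q : ℝ} (hq : 0 < q) (hqp : q < p)
    (v : ℝ≥0) (hv : v ≠ 0) (a : EuclideanSpace ℝ (Fin d)) (ha : p ≤ ‖a‖ ^ 2) :
    ∫ z, Real.exp ((p - q) / (p + q) / (2 * v) * (q - ‖a + WithLp.toLp 2 z‖ ^ 2))
        ∂isoGaussian d v
      ≤ Real.exp (-((p - q) ^ 2 / (4 * (p + q)) / v)) := by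
  have hv' : (0 : ℝ) < v := by exact_mod_cast pos_iff_ne_zero.2 hv
  have hp : 0 < p := hq.trans hqp
  -- This rate makes `1 + 2lv = 2p/(p + q)`, so at `‖a‖² = p` the exponent is `lq - l(p + q)/2 =
  -- -l(p - q)/2`.
  set l : ℝ := (p - q) / (p + q) / (2 * v) with hl
  have hpq : 0 < p - q := sub_pos.2 hqp
  have hl0 : 0 < l := by positivity
  have e : ∀ z : Fin d → ℝ, Real.exp (l * (q - ‖a + WithLp.toLp 2 z‖ ^ 2))
      = Real.exp (l * q) * Real.exp (-l * ‖a + WithLp.toLp 2 z‖ ^ 2) := by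
    intro z
    rw [← Real.exp_add]
    ring_nf
  simp_rw [e]
  rw [integral_const_mul, integral_exp_neg_mul_norm_add_sq hl0 v hv]
  have h1 : (√(1 + 2 * l * v))⁻¹ ^ d ≤ 1 := by
    refine pow_le_one₀ (by positivity) (inv_le_one_of_one_le₀ ?_)
    rw [Real.one_le_sqrt]
    have : 0 < 2 * l * v := by positivity
    linarith
  have h2 : 1 + 2 * l * v = 2 * p / (p + q) := by
    rw [hl]; field_simp; ring
  calc _ ≤ Real.exp (l * q) * (1 * Real.exp (-l * ‖a‖ ^ 2 / (1 + 2 * l * v))) := by gcongr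
    _ ≤ Real.exp (l * q) * Real.exp (-l * p / (1 + 2 * l * v)) := by
        rw [one_mul]
        gcongr ?_ * Real.exp (?_ / _)
        nlinarith
    _ = _ := by
        rw [← Real.exp_add, h2, hl]
        congr 1
        field_simp
        ring

/-! ### The barrier function -/

/-- The barrier for the outside of a ball of squared radius `p > q`, at the scale of variance
`v`. -/
noncomputable def barrier {d : ℕ} (K c p q : ℝ) (v : ℝ≥0) (z : EuclideanSpace ℝ (Fin d)) : ℝ :=
  K * (Real.exp (-c * q) - Real.exp (-c * ‖z‖ ^ 2))
    + K * Real.exp ((p - q) / (p + q) / (2 * v) * (q - ‖z‖ ^ 2))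

theorem measurable_barrier {d : ℕ} (K c p q : ℝ) (v : ℝ≥0) :
    Measurable (barrier (d := d) K c p q v) := by
  unfold barrier
  fun_prop

/-- Where `‖z‖² ≥ q` the first bracket is nonnegative; where `‖z‖² ≤ q` the peak is at least `1`,
which dominates `exp (-c‖z‖²)`. -/
theorem barrier_nonneg {d : ℕ} {K c p q : ℝ} (hK : 0 ≤ K) (hc : 0 < c) (hq : 0 < q) (hqp : q < p)
    (v : ℝ≥0) (z : EuclideanSpace ℝ (Fin d)) : 0 ≤ barrier K c p q v z := by
  have hp : 0 < p := hq.trans hqp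
  have hpq : 0 < p - q := sub_pos.2 hqp
  rw [barrier, ← mul_add]
  refine mul_nonneg hK ?_
  rcases le_total q (‖z‖ ^ 2) with h | h
  · have := Real.exp_le_exp.2 (show -c * ‖z‖ ^ 2 ≤ -c * q by nlinarith)
    have := Real.exp_pos ((p - q) / (p + q) / (2 * v) * (q - ‖z‖ ^ 2))
    linarith
  · have h1 := Real.one_le_exp
      (show 0 ≤ (p - q) / (p + q) / (2 * v) * (q - ‖z‖ ^ 2) from
        mul_nonneg (by positivity) (by linarith))
    have h2 := Real.exp_le_one_iff.2 (show -c * ‖z‖ ^ 2 ≤ 0 by nlinarith [sq_nonneg ‖z‖])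
    have := Real.exp_pos (-c * q)
    linarith

theorem integrable_barrier {d : ℕ} {K c p q : ℝ} (hc : 0 < c) (hq : 0 < q) (hqp : q < p)
    (v : ℝ≥0) (hv : v ≠ 0) (a : EuclideanSpace ℝ (Fin d)) :
    Integrable (fun z => barrier K c p q v (a + WithLp.toLp 2 z)) (isoGaussian d v) := by
  have hv' : (0 : ℝ) < v := by exact_mod_cast pos_iff_ne_zero.2 hv
  have hp : 0 < p := hq.trans hqp
  have hpq : 0 < p - q := sub_pos.2 hqp
  unfold barrier
  refine (((integrable_const _).sub (integrable_exp_neg_mul_norm_add_sq hc v a)).const_mul _).add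
    (Integrable.const_mul ?_ _)
  refine ((integrable_exp_neg_mul_norm_add_sq
    (show 0 < (p - q) / (p + q) / (2 * v) by positivity) v a).const_mul
      (Real.exp ((p - q) / (p + q) / (2 * v) * q))).congr (.of_forall fun z => ?_)
  simp only [← Real.exp_add]
  ring_nf

/-- The barrier decreases by at least the time step under Gaussian convolution. -/
theorem integral_barrier_add_le {d : ℕ} {K c p q R α h : ℝ} (hK : 0 < K) (hc : 0 < c)
    (hq : 0 < q) (hqp : q < p) (hcp : d ≤ c * p) (v : ℝ≥0) (hv : v ≠ 0) (hvh : (v : ℝ) = α * h)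
    (hα : 0 < α) (hcv : 6 * c * v ≤ 1)
    (hKα : 4 * Real.exp (c * R) ≤ K * (d * c * α))
    (hsmall : K * Real.exp (-((p - q) ^ 2 / (4 * (p + q)) / v)) ≤ h)
    (a : EuclideanSpace ℝ (Fin d)) (ha : p ≤ ‖a‖ ^ 2) (haR : ‖a‖ ^ 2 ≤ R) :
    ∫ z, barrier K c p q v (a + WithLp.toLp 2 z) ∂isoGaussian d v + h ≤ barrier K c p q v a := by
  have hv' : (0 : ℝ) < v := by exact_mod_cast pos_iff_ne_zero.2 hv
  have hh : 0 < h := by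
    rw [hvh] at hv'
    exact pos_of_mul_pos_right hv' hα.le
  have hp : 0 < p := hq.trans hqp
  have hpq : 0 < p - q := sub_pos.2 hqp
  have hint : Integrable (fun z => Real.exp ((p - q) / (p + q) / (2 * v)
      * (q - ‖a + WithLp.toLp 2 z‖ ^ 2))) (isoGaussian d v) := by
    refine ((integrable_exp_neg_mul_norm_add_sq
      (show 0 < (p - q) / (p + q) / (2 * v) by positivity) v a).const_mul
        (Real.exp ((p - q) / (p + q) / (2 * v) * q))).congr (.of_forall fun z => ?_)
    simp only [← Real.exp_add]
    ring_nf
  have hint' := integrable_exp_neg_mul_norm_add_sq hc v a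
  unfold barrier
  have hdiff : Integrable (fun z => Real.exp (-c * q) - Real.exp (-c * ‖a + WithLp.toLp 2 z‖ ^ 2))
      (isoGaussian d v) := (integrable_const _).sub hint'
  rw [integral_add (hdiff.const_mul _) (hint.const_mul _),
    integral_const_mul, integral_const_mul, integral_sub (integrable_const _) hint',
    integral_const]
  have h1 := le_integral_exp_neg_mul_norm_add_sq hc v hv hcv a (hcp.trans (by gcongr))
  have h2 := integral_exp_mul_sub_norm_add_sq_le hq hqp v hv a ha
  have h3 := mul_le_mul_of_nonneg_left h1 hK.le
  have h4 := (mul_le_mul_of_nonneg_left h2 hK.le).trans hsmall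
  -- One `h` pays for the time step, the other for the average of the peak.
  have h5 : 2 * h ≤ K * (Real.exp (-c * ‖a‖ ^ 2) * (d * c * v / 2)) := by
    have e1 : Real.exp (-c * R) ≤ Real.exp (-c * ‖a‖ ^ 2) :=
      Real.exp_le_exp.2 (by nlinarith)
    have e2 : Real.exp (-c * R) * Real.exp (c * R) = 1 := by
      rw [← Real.exp_add]; simp
    calc 2 * h = Real.exp (-c * R) * (4 * Real.exp (c * R)) * h / 2 := by
          linear_combination -2 * h * e2
      _ ≤ Real.exp (-c * R) * (K * (d * c * α)) * h / 2 := by gcongr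
      _ = K * (Real.exp (-c * R) * (d * c * v / 2)) := by rw [hvh]; ring
      _ ≤ _ := by gcongr
  have h6 := mul_nonneg hK.le (Real.exp_pos ((p - q) / (p + q) / (2 * v) * (q - ‖a‖ ^ 2))).le
  simp only [probReal_univ, one_smul]
  nlinarith

/-- Outside the ball the barrier is at most a multiple of the excess of the squared radius. -/
theorem barrier_le {d : ℕ} {K c p q h : ℝ} (hK : 0 < K) (hc : 0 < c) (hq : 0 < q) (hqp : q < p)
    (v : ℝ≥0) (hv : v ≠ 0)
    (hsmall : K * Real.exp (-((p - q) ^ 2 / (4 * (p + q)) / v)) ≤ h)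
    (a : EuclideanSpace ℝ (Fin d)) (ha : p ≤ ‖a‖ ^ 2) :
    barrier K c p q v a ≤ K * c * (‖a‖ ^ 2 - q) + h := by
  have hv' : (0 : ℝ) < v := by exact_mod_cast pos_iff_ne_zero.2 hv
  have hp : 0 < p := hq.trans hqp
  have hpq : 0 < p - q := sub_pos.2 hqp
  have h1 : Real.exp (-c * q) - Real.exp (-c * ‖a‖ ^ 2) ≤ c * (‖a‖ ^ 2 - q) := by
    have e : Real.exp (-c * ‖a‖ ^ 2) = Real.exp (-c * q) * Real.exp (-(c * (‖a‖ ^ 2 - q))) := by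
      rw [← Real.exp_add]; ring_nf
    have e1 := Real.one_sub_le_exp_neg (c * (‖a‖ ^ 2 - q))
    have e2 : Real.exp (-c * q) ≤ 1 := Real.exp_le_one_iff.2 (by nlinarith)
    have e3 : 0 ≤ c * (‖a‖ ^ 2 - q) := mul_nonneg hc.le (by linarith)
    rw [e]
    nlinarith [Real.exp_pos (-c * q)]
  have h2 : Real.exp ((p - q) / (p + q) / (2 * v) * (q - ‖a‖ ^ 2))
      ≤ Real.exp (-((p - q) ^ 2 / (4 * (p + q)) / v)) := by
    refine Real.exp_le_exp.2 ?_
    have : (p - q) / (p + q) / (2 * v) * (q - ‖a‖ ^ 2)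
        ≤ (p - q) / (p + q) / (2 * v) * (-((p - q) / 2)) := by
      gcongr
      linarith
    refine this.trans (le_of_eq ?_)
    field_simp
    ring
  have := mul_le_mul_of_nonneg_left h1 hK.le
  have := mul_le_mul_of_nonneg_left h2 hK.le
  unfold barrier
  linarith

/-! ### Exit along a time grid and the Markov property -/

theorem measurable_pathSpace_eval {d : ℕ} (t : ℝ≥0) : Measurable fun w : PathSpace d => w t :=
  (measurable_pi_apply t).comp (comap_measurable _)

/-- The exit time is at most the first exit time along a grid of mesh `h`, written as a series. -/
theorem exitTime_le_tsum {d : ℕ} {V A : Set (EuclideanSpace ℝ (Fin d))} (hVA : V ⊆ A) {h : ℝ≥0}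
    (hh : h ≠ 0) (w : PathSpace d) :
    exitTime V w
      ≤ ∑' k : ℕ, {w : PathSpace d | ∀ j < k + 1, w (j * h) ∈ A}.indicator
          (fun _ => (h : ℝ≥0∞)) w := by
  classical
  by_cases H : ∃ k : ℕ, w (k * h) ∉ A
  · have h0 := Nat.find_spec H
    calc exitTime V w ≤ ((Nat.find H * h : ℝ≥0) : ℝ≥0∞) :=
          iInf₂_le (Nat.find H * h) fun hV => h0 (hVA hV)
      _ = ∑ k ∈ Finset.range (Nat.find H), (h : ℝ≥0∞) := by simp
      _ ≤ ∑ k ∈ Finset.range (Nat.find H),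
            {w : PathSpace d | ∀ j < k + 1, w (j * h) ∈ A}.indicator (fun _ => (h : ℝ≥0∞)) w := by
          refine Finset.sum_le_sum fun k hk => ?_
          rw [Set.indicator_of_mem]
          intro j hj
          exact not_not.1 (Nat.find_min H (by have := Finset.mem_range.1 hk; omega))
      _ ≤ _ := ENNReal.sum_le_tsum _
  · push Not at H
    have : ∀ k : ℕ, {w : PathSpace d | ∀ j < k + 1, w (j * h) ∈ A}.indicator
        (fun _ => (h : ℝ≥0∞)) w = h := fun k => by
      rw [Set.indicator_of_mem]
      exact fun j _ => H j
    simp_rw [this]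
    rw [ENNReal.tsum_const_eq_top_of_ne_zero (by simpa using hh)]
    exact le_top

namespace IsWienerMeasure

variable {d : ℕ} {α : ℝ} {x : EuclideanSpace ℝ (Fin d)} {W : Measure (PathSpace d)}

theorem isProbabilityMeasure (hW : IsWienerMeasure α x W) (hd : 0 < d) :
    IsProbabilityMeasure W :=
  ((hW.isBrownianReal ⟨0, hd⟩).hasLaw_eval 0).isProbabilityMeasure

theorem ae_eval_zero (hW : IsWienerMeasure α x W) (hα : 0 < α) : ∀ᵐ w ∂W, w 0 = x := by
  have h : ∀ᵐ w ∂W, ∀ i : Fin d, ((√α)⁻¹ • (w 0 - x)) i = 0 :=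
    ae_all_iff.2 fun i => (hW.isBrownianReal i).eval_zero_ae_eq_zero
  filter_upwards [h] with w hw
  have h0 : (√α)⁻¹ • (w 0 - x) = 0 := PiLp.ext hw
  exact sub_eq_zero.1 ((smul_eq_zero.1 h0).resolve_left (by positivity))

theorem hasLaw_increment (hW : IsWienerMeasure α x W) (hα : 0 < α) (hd : 0 < d) (t h : ℝ≥0)
    (v : ℝ≥0) (hv : (v : ℝ) = α * h) :
    HasLaw (fun w i => w (t + h) i - w t i) (isoGaussian d v) W := by
  have := hW.isProbabilityMeasure hd
  have hlaw : ∀ i, HasLaw (fun w : PathSpace d => w (t + h) i - w t i) (gaussianReal 0 v) W := by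
    intro i
    have h1 := gaussianReal_const_mul (((hW.isBrownianReal i).shift t).hasLaw_eval h) (√α)
    have e1 : NNReal.mk (√α ^ 2) (sq_nonneg _) * h = v := by
      ext
      simp [Real.sq_sqrt hα.le, hv]
    rw [mul_zero, e1] at h1
    refine h1.congr (.of_forall fun w => ?_)
    have : √α ≠ 0 := by positivity
    simp only [PiLp.smul_apply, PiLp.sub_apply, smul_eq_mul]
    field_simp
    ring
  refine iIndepFun.hasLaw_pi hlaw ?_
  have h2 := hW.indep.comp (fun _ f => √α * (f (t + h) - f t)) fun i => by fun_prop
  refine h2.congr fun i => .of_forall fun w => ?_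
  have : √α ≠ 0 := by positivity
  simp only [PiLp.smul_apply, PiLp.sub_apply, smul_eq_mul, Function.comp_apply]
  field_simp
  ring

/-- Each coordinate's increment is independent of that coordinate's past, and the coordinates are
independent of each other; `iIndepFun.indepFun_pi_of_prodMk` merges the two facts. -/
theorem indepFun_increment (hW : IsWienerMeasure α x W) (hα : 0 < α) (hd : 0 < d) (t h : ℝ≥0) :
    IndepFun (fun (w : PathSpace d) (s : Set.Iic t) => w s)
      (fun (w : PathSpace d) (i : Fin d) => w (t + h) i - w t i) W := by
  have := hW.isProbabilityMeasure hd
  have hs : √α ≠ 0 := by positivity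
  have hm : ∀ (s : ℝ≥0) (i : Fin d),
      Measurable fun w : PathSpace d => ((√α)⁻¹ • (w s - x)) i := fun s i => by
    have h1 : Measurable fun z : EuclideanSpace ℝ (Fin d) => ((√α)⁻¹ • (z - x)) i := by fun_prop
    exact h1.comp (measurable_pathSpace_eval s)
  have hpair : iIndepFun (fun (i : Fin d) w =>
      ((fun s : Set.Iic t => ((√α)⁻¹ • (w s - x)) i),
        ((√α)⁻¹ • (w (t + h) - x)) i - ((√α)⁻¹ • (w t - x)) i)) W :=
    hW.indep.comp (fun _ (f : ℝ≥0 → ℝ) => ((fun s : Set.Iic t => f s), f (t + h) - f t))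
      fun i => by fun_prop
  have hind : ∀ i : Fin d, IndepFun (fun w (s : Set.Iic t) => ((√α)⁻¹ • (w s - x)) i)
      (fun w => ((√α)⁻¹ • (w (t + h) - x)) i - ((√α)⁻¹ • (w t - x)) i) W := fun i =>
    ((hW.isBrownianReal i).indepFun_shift t).symm.comp measurable_id (measurable_pi_apply h)
  have key := iIndepFun.indepFun_pi_of_prodMk
    (fun i => measurable_pi_lambda _ fun s : Set.Iic t => hm s i)
    (fun i => (hm (t + h) i).sub (hm t i)) hpair hind
  have hφ : Measurable fun (y : Fin d → Set.Iic t → ℝ) (s : Set.Iic t) =>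
      x + √α • WithLp.toLp 2 fun i => y i s := by fun_prop
  have hψ : Measurable fun (y : Fin d → ℝ) (i : Fin d) => √α * y i := by fun_prop
  have h1 : (fun (w : PathSpace d) (s : Set.Iic t) => w s)
      = (fun (y : Fin d → Set.Iic t → ℝ) (s : Set.Iic t) =>
          x + √α • WithLp.toLp 2 fun i => y i s)
        ∘ fun w i (s : Set.Iic t) => ((√α)⁻¹ • (w s - x)) i := by
    funext w s
    ext i
    simp [hs]
  have h2 : (fun (w : PathSpace d) (i : Fin d) => w (t + h) i - w t i)
      = (fun (y : Fin d → ℝ) (i : Fin d) => √α * y i)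
        ∘ fun w i => ((√α)⁻¹ • (w (t + h) - x)) i - ((√α)⁻¹ • (w t - x)) i := by
    funext w i
    simp only [PiLp.smul_apply, PiLp.sub_apply, smul_eq_mul, Function.comp_apply]
    field_simp
    ring
  rw [h1, h2]
  exact key.comp hφ hψ

/-- The Markov property at a fixed time. -/
theorem setLIntegral_eval_add (hW : IsWienerMeasure α x W) (hα : 0 < α) (hd : 0 < d) (t h v : ℝ≥0)
    (hv : (v : ℝ) = α * h) {S : Set (Set.Iic t → EuclideanSpace ℝ (Fin d))}
    (hS : MeasurableSet S) {f : EuclideanSpace ℝ (Fin d) → ℝ≥0∞} (hf : Measurable f) :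
    ∫⁻ w in {w | (fun s : Set.Iic t => w s) ∈ S}, f (w (t + h)) ∂W
      = ∫⁻ w in {w | (fun s : Set.Iic t => w s) ∈ S},
          ∫⁻ z, f (w t + WithLp.toLp 2 z) ∂isoGaussian d v ∂W := by
  have := hW.isProbabilityMeasure hd
  have hp : Measurable fun (w : PathSpace d) (s : Set.Iic t) => w s :=
    measurable_pi_lambda _ fun s => measurable_pathSpace_eval _
  have hE : MeasurableSet {w : PathSpace d | (fun s : Set.Iic t => w s) ∈ S} := hp hS
  have hlaw := hW.hasLaw_increment hα hd t h v hv
  let G : (Set.Iic t → EuclideanSpace ℝ (Fin d)) × (Fin d → ℝ) → ℝ≥0∞ :=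
    fun y => S.indicator (fun y' => f (y' ⟨t, le_refl t⟩ + WithLp.toLp 2 y.2)) y.1
  have hG : Measurable G := by
    have : G = (S ×ˢ Set.univ).indicator
        (fun y => f (y.1 ⟨t, le_refl t⟩ + WithLp.toLp 2 y.2)) := by
      funext y
      by_cases hy : y.1 ∈ S <;> simp [G, Set.mem_prod, hy]
    rw [this]
    exact Measurable.indicator (by fun_prop) (hS.prod .univ)
  have hmap := (indepFun_iff_map_prod_eq_prod_map_map hp.aemeasurable hlaw.aemeasurable).1
    (hW.indepFun_increment hα hd t h)
  rw [hlaw.map_eq] at hmap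
  calc _ = ∫⁻ w, G (fun s : Set.Iic t => w s, fun i => w (t + h) i - w t i) ∂W := by
        rw [← lintegral_indicator hE]
        refine lintegral_congr fun w => ?_
        have e : w t + WithLp.toLp 2 (fun i => w (t + h) i - w t i) = w (t + h) := by
          ext i; simp
        simp [G, Set.indicator, e]
    _ = ∫⁻ y, G y ∂((W.map fun w (s : Set.Iic t) => w s).prod (isoGaussian d v)) := by
        rw [← hmap, lintegral_map' hG.aemeasurable (hp.aemeasurable.prodMk hlaw.aemeasurable)]
    _ = ∫⁻ w, ∫⁻ z, G (fun s : Set.Iic t => w s, z) ∂isoGaussian d v ∂W := by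
        rw [lintegral_prod _ hG.aemeasurable, lintegral_map hG.lintegral_prod_right' hp]
    _ = _ := by
        rw [← lintegral_indicator hE]
        refine lintegral_congr fun w => ?_
        by_cases hw : (fun s : Set.Iic t => w s) ∈ S <;> simp [G, hw]

/-- A function that drops by at least `h` on `A` under the transition kernel of time step `h`
bounds the mean exit time from every subset of `A`. -/
theorem lintegral_exitTime_le (hW : IsWienerMeasure α x W) (hα : 0 < α) (hd : 0 < d)
    {h v : ℝ≥0} (hh : h ≠ 0) (hv : (v : ℝ) = α * h) {V A : Set (EuclideanSpace ℝ (Fin d))}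
    (hVA : V ⊆ A) (hA : MeasurableSet A) {u : EuclideanSpace ℝ (Fin d) → ℝ≥0∞}
    (hu : Measurable u)
    (hstep : ∀ a ∈ A, ∫⁻ z, u (a + WithLp.toLp 2 z) ∂isoGaussian d v + h ≤ u a) :
    ∫⁻ w, exitTime V w ∂W ≤ u x := by
  have := hW.isProbabilityMeasure hd
  let E : ℕ → Set (PathSpace d) := fun n => {w | ∀ j < n, w (j * h) ∈ A}
  have hE : ∀ n, MeasurableSet (E n) := fun n => by
    have : E n = ⋂ j ∈ Set.Iio n, (fun w : PathSpace d => w (j * h)) ⁻¹' A := by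
      ext w; simp [E]
    rw [this]
    exact MeasurableSet.biInter (Set.to_countable _) fun j _ => measurable_pathSpace_eval _ hA
  -- The expected remaining budget on paths still in `A` at all earlier grid times; its decrements
  -- telescope against the exit time series.
  let b : ℕ → ℝ≥0∞ := fun n => ∫⁻ w in E n, u (w (n * h)) ∂W
  have hb : ∀ n, b (n + 1) + h * W (E (n + 1)) ≤ b n := by
    intro n
    have hle : ∀ j : Fin (n + 1), (j : ℝ≥0) * h ≤ n * h := fun j => by
      gcongr
      exact Nat.lt_succ_iff.1 j.2
    let S : Set (Set.Iic ((n : ℝ≥0) * h) → EuclideanSpace ℝ (Fin d)) :=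
      {y | ∀ j : Fin (n + 1), y ⟨j * h, hle j⟩ ∈ A}
    have hS : MeasurableSet S := by
      have : S = ⋂ j : Fin (n + 1), (fun y => y ⟨j * h, hle j⟩) ⁻¹' A := by
        ext y; simp [S]
      rw [this]
      exact MeasurableSet.iInter fun j => measurable_pi_apply _ hA
    -- `E (n + 1)` looks at the grid only up to time `n * h`, so the next increment is independent
    -- of it.
    have hES : E (n + 1) = {w | (fun s : Set.Iic ((n : ℝ≥0) * h) => w s) ∈ S} := by
      ext w
      exact ⟨fun hw j => hw j j.2, fun hw j hj => hw ⟨j, hj⟩⟩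
    have hmk := hW.setLIntegral_eval_add hα hd (n * h) h v hv hS hu
    rw [← hES] at hmk
    have hsucc : ((n + 1 : ℕ) : ℝ≥0) * h = n * h + h := by push_cast; ring
    calc b (n + 1) + h * W (E (n + 1))
        = ∫⁻ w in E (n + 1), (∫⁻ z, u (w (n * h) + WithLp.toLp 2 z) ∂isoGaussian d v) + h ∂W := by
          rw [lintegral_add_right _ measurable_const, setLIntegral_const, ← hmk]
          simp only [b, hsucc]
      _ ≤ ∫⁻ w in E (n + 1), u (w (n * h)) ∂W :=
          setLIntegral_mono' (hE _) fun w hw => hstep _ (hw n (Nat.lt_succ_self n))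
      _ ≤ b n := lintegral_mono_set fun w hw j hj => hw j (hj.trans (Nat.lt_succ_self n))
  have hsum : ∀ n, b n + ∑ k ∈ Finset.range n, h * W (E (k + 1)) ≤ b 0 := by
    intro n
    induction n with
    | zero => simp
    | succ n ih =>
      rw [Finset.sum_range_succ]
      calc _ = (b (n + 1) + h * W (E (n + 1))) + ∑ k ∈ Finset.range n, h * W (E (k + 1)) := by
            ring
        _ ≤ b n + ∑ k ∈ Finset.range n, h * W (E (k + 1)) := by gcongr; exact hb n
        _ ≤ _ := ih
  have hb0 : b 0 = u x := by
    have : E 0 = Set.univ := by ext; simp [E]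
    simp only [b, this, Measure.restrict_univ, Nat.cast_zero, zero_mul]
    rw [lintegral_congr_ae ((hW.ae_eval_zero hα).mono fun w hw => by rw [hw])]
    simp
  calc ∫⁻ w, exitTime V w ∂W
      ≤ ∫⁻ w, ∑' k : ℕ, (E (k + 1)).indicator (fun _ => (h : ℝ≥0∞)) w ∂W :=
        lintegral_mono fun w => exitTime_le_tsum hVA hh w
    _ = ∑' k : ℕ, h * W (E (k + 1)) := by
        rw [lintegral_tsum fun k => (measurable_const.indicator (hE _)).aemeasurable]
        simp_rw [lintegral_indicator_const (hE _)]
    _ ≤ u x := ENNReal.tsum_le_of_sum_range_le fun n =>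
        le_add_self.trans ((hsum n).trans_eq hb0)

theorem lintegral_exitTime_eq_zero (hW : IsWienerMeasure α x W) (hα : 0 < α)
    {V : Set (EuclideanSpace ℝ (Fin d))} (hx : x ∉ V) : ∫⁻ w, exitTime V w ∂W = 0 := by
  rw [lintegral_congr_ae (g := fun _ => 0), lintegral_zero]
  filter_upwards [hW.ae_eval_zero hα] with w hw
  exact le_antisymm (iInf₂_le_of_le 0 (by rwa [hw]) (by simp)) zero_le

end IsWienerMeasure

/-! ### Exit from annuli -/

/-- The mean exit time from a subset of a closed annulus is bounded linearly in the distance of the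
starting point to the inner ball, uniformly in the variance and in the inner radius. -/
theorem exists_forall_lintegral_exitTime_le {d : ℕ} (hd : 0 < d) {α₀ r R : ℝ} (hα₀ : 0 < α₀)
    (hr : 0 < r) (hrR : r ≤ R) :
    ∃ C : ℝ, 0 < C ∧ ∀ α : ℝ, α₀ ≤ α → ∀ (x : EuclideanSpace ℝ (Fin d)) (W : Measure (PathSpace d)),
      IsWienerMeasure α x W → ∀ (y : EuclideanSpace ℝ (Fin d)) (r₁ : ℝ), r ≤ r₁ → r₁ ≤ R →
      ∀ V : Set (EuclideanSpace ℝ (Fin d)), V ⊆ {z | r₁ ≤ ‖z - y‖ ∧ ‖z - y‖ ≤ R} →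
      ∀ δ : ℝ, 0 < δ → ‖x - y‖ ≤ r₁ + δ →
        ∫⁻ w, exitTime V w ∂W ≤ ENNReal.ofReal (C * δ) := by
  have hd' : (0 : ℝ) < d := by exact_mod_cast hd
  have hR : 0 < R := hr.trans_le hrR
  -- This `c` gives `d ≤ c * r₁ ^ 2` for every `r₁ ≥ r`, the subharmonicity threshold; `K` then
  -- normalises the drop at the smallest variance `α₀` and the largest radius `R`.
  set c : ℝ := d / r ^ 2 with hc
  have hc0 : 0 < c := by positivity
  set K : ℝ := 4 * Real.exp (c * R ^ 2) / (d * c * α₀) with hK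
  have hK0 : 0 < K := by positivity
  refine ⟨K * c * (3 * R) + 1, by positivity, ?_⟩
  intro α hα x W hW y r₁ hr₁ hr₁R V hV δ hδ hx
  have hα' : 0 < α := hα₀.trans_le hα
  by_cases hxV : x ∈ V
  swap
  · rw [hW.lintegral_exitTime_eq_zero hα' hxV]
    exact zero_le
  obtain ⟨hx₁, hx₂⟩ := hV hxV
  have hr₁0 : 0 < r₁ := hr.trans_le hr₁
  set p : ℝ := r₁ ^ 2 with hp
  have hp0 : 0 < p := by positivity
  -- A squared radius strictly below `p` leaves room for the peak, while `p - q ≤ R * δ` keeps the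
  -- loss linear in `δ`.
  set q : ℝ := p * R / (R + δ) with hq
  have hq0 : 0 < q := by positivity
  have hpq : p - q = p * δ / (R + δ) := by
    rw [hq]; field_simp; ring
  have hqp : q < p := by
    rw [← sub_pos, hpq]; positivity
  have hcp : d ≤ c * p := by
    rw [hc, hp, div_mul_eq_mul_div, le_div_iff₀ (by positivity)]
    gcongr
  set κ : ℝ := (p - q) ^ 2 / (4 * (p + q)) with hκ
  have hκ0 : 0 < κ := by
    have := sub_pos.2 hqp
    positivity
  -- The three bounds serve, in order, the final estimate, `6 * c * v ≤ 1`, and the smallness of the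
  -- peak.
  set h : ℝ := min δ (min (1 / (6 * c * α)) (κ ^ 2 / (2 * K * α ^ 2))) with hh
  have hh0 : 0 < h := by positivity
  have hhδ : h ≤ δ := min_le_left _ _
  have hh1 : h ≤ 1 / (6 * c * α) := (min_le_right _ _).trans (min_le_left _ _)
  have hh2 : h ≤ κ ^ 2 / (2 * K * α ^ 2) := (min_le_right _ _).trans (min_le_right _ _)
  let h' : ℝ≥0 := ⟨h, hh0.le⟩
  let v : ℝ≥0 := ⟨α * h, by positivity⟩
  have hvr : (v : ℝ) = α * h := rfl
  have hv0 : 0 < v := by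
    rw [← NNReal.coe_pos, hvr]; positivity
  have hh'0 : 0 < h' := by
    rw [← NNReal.coe_pos]; exact hh0
  have hcv : 6 * c * v ≤ 1 := by
    rw [le_div_iff₀ (by positivity)] at hh1
    rw [hvr]
    linarith
  have hsmall : K * Real.exp (-(κ / v)) ≤ h := by
    have := exp_neg_div_le hκ0 (NNReal.coe_pos.2 hv0)
    calc _ ≤ K * (2 * (v : ℝ) ^ 2 / κ ^ 2) := by gcongr
      _ = h * (h * (2 * K * α ^ 2)) / κ ^ 2 := by rw [hvr]; ring
      _ ≤ h * κ ^ 2 / κ ^ 2 := by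
        gcongr
        rwa [le_div_iff₀ (by positivity)] at hh2
      _ = h := by field_simp
  have hKα : 4 * Real.exp (c * R ^ 2) ≤ K * (d * c * α) := by
    calc 4 * Real.exp (c * R ^ 2) = K * (d * c * α₀) := by rw [hK]; field_simp
      _ ≤ _ := by gcongr
  refine (hW.lintegral_exitTime_le hα' hd hh'0.ne' hvr (A := {z | r₁ ≤ ‖z - y‖ ∧ ‖z - y‖ ≤ R})
    (u := fun z => ENNReal.ofReal (barrier K c p q v (z - y))) hV ?_ ?_ ?_).trans ?_
  · have hm : Measurable fun z : EuclideanSpace ℝ (Fin d) => ‖z - y‖ := by fun_prop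
    exact (measurableSet_le measurable_const hm).inter (measurableSet_le hm measurable_const)
  · exact ((measurable_barrier K c p q v).comp (measurable_id.sub_const y)).ennreal_ofReal
  · rintro a ⟨ha₁, ha₂⟩
    have e : ∀ z : Fin d → ℝ, a + WithLp.toLp 2 z - y = (a - y) + WithLp.toLp 2 z := fun z => by
      abel
    simp_rw [e]
    have hnn := barrier_nonneg (d := d) hK0.le hc0 hq0 hqp v
    rw [← ofReal_integral_eq_lintegral_ofReal (integrable_barrier hc0 hq0 hqp v hv0.ne' _)
      (.of_forall fun z => hnn _),
      show (h' : ℝ≥0∞) = ENNReal.ofReal h from (ENNReal.ofReal_eq_coe_nnreal hh0.le).symm,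
      ← ENNReal.ofReal_add (integral_nonneg fun z => hnn _) hh0.le]
    exact ENNReal.ofReal_le_ofReal (integral_barrier_add_le hK0 hc0 hq0 hqp hcp v hv0.ne' hvr hα'
      hcv hKα hsmall _ (by rw [hp]; gcongr) (by gcongr))
  · refine ENNReal.ofReal_le_ofReal ((barrier_le hK0 hc0 hq0 hqp v hv0.ne' hsmall (x - y)
      (by rw [hp]; gcongr)).trans ?_)
    have h1 : p - q ≤ R * δ := by
      rw [hpq, div_le_iff₀ (by positivity)]
      have : p ≤ R * R := by rw [hp, sq]; gcongr
      nlinarith [mul_le_mul_of_nonneg_right this hδ.le, mul_pos hR (mul_pos hδ hδ)]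
    have h2 : ‖x - y‖ ^ 2 - p ≤ 2 * R * δ := by rw [hp]; nlinarith
    have h3 : K * c * (‖x - y‖ ^ 2 - q) ≤ K * c * (3 * R * δ) := by
      gcongr
      linarith
    linarith

/-! ### Domains with exterior balls -/

/-- Mean exit times near a domain with the exterior ball condition, from neighbourhoods `V` of the
domain which reach at most `ε` beyond it. -/
theorem ExteriorBallCondition.exists_forall_lintegral_exitTime_le {d : ℕ} (hd : 0 < d)
    {α₀ r₀ : ℝ} (hα₀ : 0 < α₀) {U : Set (EuclideanSpace ℝ (Fin d))} (hU : IsOpen U)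
    (hUb : Bornology.IsBounded U) (hr₀ : 0 < r₀) (hext : ExteriorBallCondition U r₀) :
    ∃ C : ℝ, 0 < C ∧ ∀ α : ℝ, α₀ ≤ α → ∀ (x : EuclideanSpace ℝ (Fin d)) (W : Measure (PathSpace d)),
      IsWienerMeasure α x W → ∀ ε η : ℝ, 0 ≤ ε → ε ≤ r₀ / 2 → 0 < ε + η →
      ∀ V : Set (EuclideanSpace ℝ (Fin d)), (∀ z ∈ V, ∃ u ∈ U, dist z u ≤ ε) →
      ∀ ξ ∈ frontier U, dist x ξ ≤ η →
        ∫⁻ w, exitTime V w ∂W ≤ ENNReal.ofReal (C * (ε + η)) := by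
  have hdiam : 0 ≤ Metric.diam (closure U) := Metric.diam_nonneg
  obtain ⟨C, hC, H⟩ := _root_.exists_forall_lintegral_exitTime_le (d := d) hd hα₀
    (r := r₀ / 2) (R := Metric.diam (closure U) + 2 * r₀) (half_pos hr₀) (by linarith)
  refine ⟨C, hC, fun α hα x W hW ε η hε hεr hεη V hV ξ hξ hxξ => ?_⟩
  obtain ⟨y, hy⟩ := hext ξ hξ
  have hξy : dist ξ y ≤ r₀ := (hy.ge (Set.mem_singleton ξ)).1
  have hξU : ξ ∉ U := fun h => by
    rw [hU.frontier_eq] at hξ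
    exact hξ.2 h
  -- Shrinking the exterior ball by `ε` keeps it clear of `V`; then `x` is within `ε + η` of the
  -- smaller ball.
  refine H α hα x W hW y (r₀ - ε) (by linarith) (by linarith) V (fun z hz => ?_) (ε + η) hεη ?_
  · obtain ⟨u, hu, hzu⟩ := hV z hz
    have huy : r₀ < dist u y := by
      by_contra! hle
      have : u ∈ ({ξ} : Set _) := hy ▸ ⟨hle, subset_closure hu⟩
      exact hξU (Set.mem_singleton_iff.1 this ▸ hu)
    have huξ : dist u ξ ≤ Metric.diam (closure U) :=
      Metric.dist_le_diam_of_mem hUb.closure (subset_closure hu) (frontier_subset_closure hξ)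
    rw [Set.mem_ofPred_eq, ← dist_eq_norm]
    constructor
    · linarith [dist_triangle u z y, dist_comm u z]
    · linarith [dist_triangle z u y, dist_triangle u ξ y]
  · rw [← dist_eq_norm]
    linarith [dist_triangle x ξ y]

/-- Guards against the default value `0` of `Metric.infDist` to an empty set, where there is no
nearest point to use. -/
theorem Bornology.IsBounded.frontier_nonempty {E : Type*} [NormedAddCommGroup E] [NormedSpace ℝ E]
    [Nontrivial E] {s : Set E} (hs : Bornology.IsBounded s) (hne : s.Nonempty) :
    (frontier s).Nonempty := by
  rw [Set.nonempty_iff_ne_empty, Ne, frontier_eq_empty_iff]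
  rintro (rfl | rfl)
  · exact Set.not_nonempty_empty hne
  · exact NormedSpace.unbounded_univ ℝ E hs

theorem mainTheorem11 (d : ℕ) (hd : 3 ≤ d) (α₀ : ℝ) (hα₀ : 0 < α₀) :
    -- annuli: the constant depends on `r₁`, `r₂` (and `d`, `α₀`), not on the variance `α ≥ α₀`
    (∀ r₁ r₂ : ℝ, 0 < r₁ → r₁ < r₂ →
      ∃ C : ℝ, 0 < C ∧
        ∀ α : ℝ, α₀ ≤ α →
        ∀ W : EuclideanSpace ℝ (Fin d) → Measure (PathSpace d), (∀ x, IsWienerMeasure α x (W x)) →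
        ∀ x ∈ closure (annulus d r₁ r₂),
          ∫⁻ w, exitTime (annulus d r₁ r₂) w ∂(W x)
            ≤ ENNReal.ofReal (C * Metric.infDist x (frontier (Metric.ball 0 r₁)))) ∧
    -- domains with an exterior ball condition: the constant is independent of `α ≥ α₀` and `δ`
    (∀ U : Set (EuclideanSpace ℝ (Fin d)), IsOpen U → Bornology.IsBounded U →
      ∀ r₀ : ℝ, 0 < r₀ → ExteriorBallCondition U r₀ →
      ∃ C : ℝ, 0 < C ∧
        ∀ α : ℝ, α₀ ≤ α →
        ∀ W : EuclideanSpace ℝ (Fin d) → Measure (PathSpace d), (∀ x, IsWienerMeasure α x (W x)) →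
        ∀ δ : ℝ, 0 < δ → δ < r₀ / 2 →
          (⨆ x ∈ {x | Metric.infDist x (frontier U) ≤ δ},
              ∫⁻ w, exitTime U w ∂(W x)) ≤ ENNReal.ofReal (C * δ) ∧
          (⨆ x ∈ {x | Metric.infDist x (frontier (Metric.thickening δ U)) ≤ 2 * δ},
              ∫⁻ w, exitTime (Metric.thickening δ U) w ∂(W x)) < ENNReal.ofReal (C * δ)) := by
  have hd0 : 0 < d := by omega
  have : Nonempty (Fin d) := ⟨⟨0, hd0⟩⟩
  constructor
  · intro r₁ r₂ hr₁ hr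
    obtain ⟨C, hC, H⟩ := exists_forall_lintegral_exitTime_le (d := d) hd0 hα₀ hr₁ hr.le
    refine ⟨C, hC, fun α hα W hW x _ => ?_⟩
    by_cases hx : x ∈ annulus d r₁ r₂
    swap
    · rw [(hW x).lintegral_exitTime_eq_zero (hα₀.trans_le hα) hx]
      exact zero_le
    have hx₁ : r₁ < ‖x‖ := by
      have := hx.2
      rwa [mem_closedBall_zero_iff, not_le] at this
    have hdist : ‖x‖ - r₁ ≤ Metric.infDist x (frontier (Metric.ball 0 r₁)) := by
      rw [frontier_ball _ hr₁.ne',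
        Metric.le_infDist (NormedSpace.sphere_nonempty.2 hr₁.le)]
      intro z hz
      rw [mem_sphere_zero_iff_norm] at hz
      rw [dist_eq_norm, ← hz]
      exact norm_sub_norm_le x z
    refine (H α hα x (W x) (hW x) 0 r₁ le_rfl hr.le _ (fun z hz => ?_) (‖x‖ - r₁)
      (sub_pos.2 hx₁) (by simp)).trans (ENNReal.ofReal_le_ofReal (by gcongr))
    have h1 := hz.1
    have h2 := hz.2
    rw [mem_ball_zero_iff] at h1
    rw [mem_closedBall_zero_iff, not_le] at h2
    rw [Set.mem_ofPred_eq, sub_zero]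
    exact ⟨h2.le, h1.le⟩
  · intro U hU hUb r₀ hr₀ hext
    obtain ⟨C, hC, H⟩ := hext.exists_forall_lintegral_exitTime_le hd0 hα₀ hU hUb hr₀
    -- The thickened domain needs `4 * C`; the extra `C` makes its bound strict.
    refine ⟨5 * C, by positivity, fun α hα W hW δ hδ hδr => ⟨iSup₂_le fun x hx => ?_, ?_⟩⟩
    · by_cases hxU : x ∈ U
      swap
      · rw [(hW x).lintegral_exitTime_eq_zero (hα₀.trans_le hα) hxU]
        exact zero_le
      obtain ⟨ξ, hξ, hdξ⟩ :=
        isClosed_frontier.exists_infDist_eq_dist (hUb.frontier_nonempty ⟨x, hxU⟩) x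
      rw [Set.mem_ofPred_eq, hdξ] at hx
      refine (H α hα x (W x) (hW x) 0 δ le_rfl (by positivity) (by linarith) U
        (fun z hz => ⟨z, hz, (dist_self z).le⟩) ξ hξ hx).trans
        (ENNReal.ofReal_le_ofReal ?_)
      have := mul_pos hC hδ
      linarith
    · have hCδ := mul_pos hC hδ
      refine lt_of_le_of_lt (iSup₂_le fun x hx => ?_)
        ((ENNReal.ofReal_lt_ofReal_iff (by positivity)).2
          (show C * (δ + 3 * δ) < 5 * C * δ by linarith))
      by_cases hxU : x ∈ Metric.thickening δ U
      swap
      · rw [(hW x).lintegral_exitTime_eq_zero (hα₀.trans_le hα) hxU]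
        exact zero_le
      obtain ⟨ζ, hζ, hdζ⟩ := isClosed_frontier.exists_infDist_eq_dist
        (hUb.thickening.frontier_nonempty ⟨x, hxU⟩) x
      rw [Set.mem_ofPred_eq, hdζ] at hx
      have hζU : Metric.infDist ζ U = δ := by
        rw [Metric.infDist, Metric.frontier_thickening_subset U hζ, ENNReal.toReal_ofReal hδ.le]
      have hUne : U.Nonempty := by
        obtain ⟨u, hu, -⟩ := Metric.mem_thickening_iff.1 hxU
        exact ⟨u, hu⟩
      have hζU' : ζ ∈ Uᶜ := fun h => by
        rw [Metric.infDist_zero_of_mem h] at hζU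
        exact hδ.ne hζU
      -- The exterior balls belong to `U`, not to its thickening, so `ζ` is moved by `δ` to a
      -- nearest point of `frontier U`; hence `dist x ξ ≤ 2δ + δ`.
      obtain ⟨ξ, hξ, hdξ⟩ := exists_mem_frontier_infDist_compl_eq_dist hζU'
        (by rwa [Ne, Set.compl_univ_iff, ← Ne, ← Set.nonempty_iff_ne_empty])
      rw [compl_compl, hζU] at hdξ
      rw [frontier_compl] at hξ
      refine H α hα x (W x) (hW x) δ (3 * δ) hδ.le hδr.le (by linarith) _ (fun z hz => ?_) ξ hξ
        (by linarith [dist_triangle x ζ ξ])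
      obtain ⟨u, hu, hzu⟩ := Metric.mem_thickening_iff.1 hz
      exact ⟨u, hu, hzu.le⟩
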